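/- For a bounded set $K\subset\mathbb C$, a point $x\in K$ and $r>0$, let $$\beta_K(x,r)=\inf_{\ell}\ \sup_{z\in K\cap B(x,r)}\frac{\operatorname{dist}(z,\ell)}{r},$$ where the infimum is taken over all lines $\ell$ in the plane $\mathbb C=\mathbb R^2$, and let $$\beta_\infty^K(x)=\int_0^1\beta_K(x,t)^2\,\frac{dt}{t}\in[0,\infty].$$ Let $\mathcal H^1$ denote the one-dimensional Hausdorff (outer) measure. Proposition 1. Let $\varepsilon\in[0,1)$ and $L>1$. There exists $M>0$, depending only on $\varepsilon$ and $L$, such that every curve $\gamma\subset\mathbb C$ joining $0$ to $1$ (that is, every image $\gamma$ of a continuous map $[0,1]\to\mathbb C$ sending $0$ to $0$ and $1$ to $1$) for which there is a set $E\subset\mathbb C$ with $\mathcal H^1(E)\le\varepsilon$ and $$\beta_\infty^\gamma(x)\ge M\qquad\text{for all }x\in\gamma\setminus E,$$ has length $\mathcal H^1(\gamma)>L$. -/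

import Mathlib

open MeasureTheory
open scoped ENNReal

/-- The set of (real, affine) lines of the plane `ℂ`. A subspace with one-dimensional direction
is automatically nonempty. -/
def planeLines : Set (AffineSubspace ℝ ℂ) :=
  {ℓ | Module.finrank ℝ ℓ.direction = 1}

/-- The `β`-number `β_K(x, r) = inf_ℓ sup_{z ∈ K ∩ B(x, r)} dist(z, ℓ) / r`, the infimum being
taken over all lines `ℓ` of the plane. It takes values in `[0, ∞]`, so that neither the infimum
nor the supremum has junk values. -/
noncomputable def betaNumber (K : Set ℂ) (x : ℂ) (r : ℝ) : ℝ≥0∞ :=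
  ⨅ ℓ ∈ planeLines, ⨆ z ∈ K ∩ Metric.ball x r,
    Metric.infEDist z (ℓ : Set ℂ) / ENNReal.ofReal r

/-- `β_∞^K(x) = ∫_0^1 β_K(x, t)² dt / t`, with values in `[0, ∞]`. -/
noncomputable def betaInfinity (K : Set ℂ) (x : ℂ) : ℝ≥0∞ :=
  ∫⁻ t in Set.Ioc (0 : ℝ) 1, betaNumber K x t ^ 2 / ENNReal.ofReal t

/-! The proof is integral geometry in the style of Crofton. If the curve is not flat near `x` at
scale `ρ`, many lines meet it twice near `x`, at points about `ρ` apart: `betaNumber_sq_le` bounds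
`β²` by the measure of these lines divided by `ρ`, and the bound depends on `x` only through its
real part.

Sum over geometric scales, integrate over the real part `u`, and exchange the integrals so that the
line is fixed. Each double hit at a new scale contributes a further intersection point, separated
from those already found, so the sum for one line is at most the size of a separated set in its
intersection with the curve (`exists_finset_separated_extension`). Integrating this count over all
lines gives at most a constant times the length, by an Eilenberg-type covering argument
(`lintegral_sum_doubleHits_le`).

If the length were at most `L`, the integral over `u` would be bounded by a constant `C` depending
only on `L`. But `E` projects to a set of measure at most `ε`, so `β_∞ ≥ M` over abscissas of
measure at least `1 - ε`, which is impossible once `M * (1 - ε) > C`. -/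

/-! ### Heights in a rotated frame -/

/-- The signed height of `y` in the frame rotated by `θ`; its level sets are the lines of
direction `exp (iθ)`. -/
noncomputable def height (θ : ℝ) (y : ℂ) : ℝ :=
  y.im * Real.cos θ - y.re * Real.sin θ

lemma height_sub (θ : ℝ) (y z : ℂ) : height θ (y - z) = height θ y - height θ z := by
  simp only [height, Complex.sub_im, Complex.sub_re]; ring

lemma continuous_height : Continuous fun a : ℝ × ℂ ↦ height a.1 a.2 := by
  unfold height; fun_prop

lemma continuous_height_right (θ : ℝ) : Continuous (height θ) := by
  unfold height; fun_prop

lemma height_sq_add_sq (θ : ℝ) (y : ℂ) :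
    height θ y ^ 2 + (y.re * Real.cos θ + y.im * Real.sin θ) ^ 2 = ‖y‖ ^ 2 := by
  rw [← Complex.normSq_eq_norm_sq, Complex.normSq_apply, height]
  linear_combination (y.re ^ 2 + y.im ^ 2) * Real.sin_sq_add_cos_sq θ

lemma abs_height_le (θ : ℝ) (y : ℂ) : |height θ y| ≤ ‖y‖ := by
  apply abs_le_of_sq_le_sq _ (norm_nonneg y)
  nlinarith [height_sq_add_sq θ y, sq_nonneg (y.re * Real.cos θ + y.im * Real.sin θ)]

lemma lipschitzWith_height (θ : ℝ) : LipschitzWith 1 (height θ) := by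
  refine LipschitzWith.of_dist_le_mul fun y z ↦ ?_
  rw [Real.dist_eq, ← height_sub, dist_eq_norm, NNReal.coe_one, one_mul]
  exact abs_height_le θ _

lemma height_add (φ α : ℝ) (y : ℂ) :
    height (φ + α) y = height φ y * Real.cos α
      - (y.re * Real.cos φ + y.im * Real.sin φ) * Real.sin α := by
  simp only [height, Real.cos_add, Real.sin_add]; ring

/-- The height of `y` changes substantially when a direction almost parallel to `y` is rotated. -/
lemma le_abs_height_add {ρ k δ φ : ℝ} {y : ℂ} (hy : ‖y‖ = ρ) (hk : 0 < k) (hkρ : k ≤ ρ)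
    (hδ : δ = k / (96 * ρ)) (h : |height φ y| < k / 1000) :
    k / 1000 ≤ |height (φ + δ) y| := by
  have hρ : 0 < ρ := hk.trans_le hkρ
  set g := height φ y with hg
  set c := y.re * Real.cos φ + y.im * Real.sin φ with hc
  have hsq : g ^ 2 + c ^ 2 = ρ ^ 2 := by rw [hg, hc, height_sq_add_sq, hy]
  have hg2 : |g| ^ 2 ≤ (ρ / 1000) ^ 2 := by
    apply pow_le_pow_left₀ (abs_nonneg _); linarith
  rw [sq_abs] at hg2
  have hc2 : ρ / 2 ≤ |c| := by
    apply abs_le_of_sq_le_sq' _ (abs_nonneg c) |>.2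
    rw [sq_abs]; nlinarith
  have hδ0 : 0 < δ := by rw [hδ]; positivity
  have hδ1 : δ ≤ 1 / 96 := by
    rw [hδ, div_le_div_iff₀ (by positivity) (by norm_num)]; linarith
  have hsin : δ / 2 ≤ Real.sin δ := by
    have := Real.sin_gt_sub_cube hδ0
    nlinarith [mul_pos hδ0 hδ0]
  have hδρ : δ * ρ = k / 96 := by rw [hδ]; field_simp
  rw [height_add, ← hg, ← hc]
  have h1 : |c * Real.sin δ| - |g * Real.cos δ| ≤ |g * Real.cos δ - c * Real.sin δ| := by
    rw [abs_sub_comm]; exact abs_sub_abs_le_abs_sub _ _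
  have h2 : |g * Real.cos δ| ≤ |g| := by
    rw [abs_mul]; exact mul_le_of_le_one_right (abs_nonneg _) (Real.abs_cos_le_one _)
  -- The rotation moves the height by about `ρ / 2 * (δ / 2) = k / 384`, which is more than `2 * (k
  -- / 1000)`.
  have h3 : k / 384 ≤ |c * Real.sin δ| := by
    rw [abs_mul, abs_of_nonneg (by linarith : 0 ≤ Real.sin δ)]
    have : ρ / 2 * (δ / 2) ≤ |c| * Real.sin δ := by gcongr
    nlinarith
  linarith

/-! ### Lines meeting two segments -/

/-- The lines, described by direction and height, that meet both segments `[p, q]` and `[z, w]`. -/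
def commonTransversals (p q z w : ℂ) : Set (ℝ × ℝ) :=
  {a | a.1 ∈ Set.Icc (-10) 10 ∧ a.2 ∈ Set.uIcc (height a.1 p) (height a.1 q) ∧
    a.2 ∈ Set.uIcc (height a.1 z) (height a.1 w)}

lemma isClosed_commonTransversals (p q z w : ℂ) : IsClosed (commonTransversals p q z w) := by
  have h : ∀ y : ℂ, Continuous fun a : ℝ × ℝ ↦ height a.1 y := fun y ↦
    continuous_height.comp (continuous_fst.prodMk continuous_const)
  have h2 : ∀ y y' : ℂ, IsClosed {a : ℝ × ℝ | a.2 ∈ Set.uIcc (height a.1 y) (height a.1 y')} :=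
    fun y y' ↦ (isClosed_le ((h y).min (h y')) continuous_snd).inter
      (isClosed_le continuous_snd ((h y).max (h y')))
  exact (isClosed_Icc.preimage continuous_fst).inter ((h2 p q).inter (h2 z w))

lemma commonTransversals_comm (p q z w : ℂ) :
    commonTransversals q p z w = commonTransversals p q z w := by
  ext a; simp only [commonTransversals, Set.mem_ofPred_eq, Set.uIcc_comm (height a.1 q)]

lemma ofReal_le_volume_uIcc_inter {a b c d e k : ℝ} (hb : b ≤ a - k) (hc : a + k ≤ c)
    (hk : 0 ≤ k) (hd : d = a) (he : k ≤ |e - a|) :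
    ENNReal.ofReal k ≤ volume (Set.uIcc b c ∩ Set.uIcc d e) := by
  subst hd
  rcases le_abs.1 he with h | h
  · have : Set.Icc d (d + k) ⊆ Set.uIcc b c ∩ Set.uIcc d e := by
      rw [Set.uIcc_of_le (by linarith), Set.uIcc_of_le (by linarith)]
      rintro s ⟨h1, h2⟩; exact ⟨⟨by linarith, by linarith⟩, ⟨h1, by linarith⟩⟩
    refine le_trans ?_ (measure_mono this)
    rw [Real.volume_Icc, add_sub_cancel_left]
  · have : Set.Icc (d - k) d ⊆ Set.uIcc b c ∩ Set.uIcc d e := by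
      rw [Set.uIcc_of_le (by linarith), Set.uIcc_of_ge (by linarith)]
      rintro s ⟨h1, h2⟩; exact ⟨⟨by linarith, by linarith⟩, ⟨by linarith, h2⟩⟩
    refine le_trans ?_ (measure_mono this)
    rw [Real.volume_Icc, sub_sub_cancel]

/-- Turn the line from `z` to `p` by a small angle `α` towards `q`: it then passes between `p` and
`q`, and so do its translates by at most `k / 1000`, where `k` is the height of `q` over the
original line. A positive proportion of these angles also lets `[z, w]` span heights of size `k /
1000`. The measure is thus at least of order `k * α₀`, with `α₀` of order `k / ρ`. -/
lemma volume_commonTransversals_of_pos {p q z w : ℂ} {ρ : ℝ} (hρ : 0 < ρ) (hw : ‖w - z‖ = ρ)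
    (hpq : ‖q - p‖ = ρ) (hp : 8 * ρ ≤ ‖p - z‖) (hp' : ‖p - z‖ ≤ 12 * ρ) (hq : ‖q - z‖ ≤ 12 * ρ)
    (hpos : 0 < ((q - p) * (starRingEnd ℂ) (p - z)).im) :
    ENNReal.ofReal (((q - p) * (starRingEnd ℂ) (p - z)).im ^ 2 / (6e7 * ρ ^ 3)) ≤
      volume (commonTransversals p q z w) := by
  set κ := ((q - p) * (starRingEnd ℂ) (p - z)).im with hκ
  set D := ‖p - z‖ with hD
  have hD0 : 0 < D := by linarith
  set φ := (p - z).arg with hφ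
  have hre : D * Real.cos φ = (p - z).re := Complex.norm_mul_cos_arg _
  have him : D * Real.sin φ = (p - z).im := Complex.norm_mul_sin_arg _
  set k := height φ (q - p) with hkdef
  have hkκ : k * D = κ := by
    have : κ = (q - p).im * (p - z).re - (q - p).re * (p - z).im := by
      rw [hκ]; simp [Complex.mul_im]; ring
    rw [this, hkdef, height, ← hre, ← him]; ring
  have hk : 0 < k := pos_of_mul_pos_left (hkκ ▸ hpos) hD0.le
  have hkρ : k ≤ ρ := hpq ▸ (le_abs_self _).trans (abs_height_le φ (q - p))
  have hsc := Real.sin_sq_add_cos_sq φ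
  have hp0 : height φ (p - z) = 0 := by rw [height, ← hre, ← him]; ring
  have hp1 : (p - z).re * Real.cos φ + (p - z).im * Real.sin φ = D := by
    rw [← hre, ← him]; linear_combination D * hsc
  set m := (q - z).re * Real.cos φ + (q - z).im * Real.sin φ with hm
  have hm12 : m ≤ 12 * ρ := by
    refine le_trans ?_ hq
    apply abs_le_of_sq_le_sq' _ (norm_nonneg _) |>.2
    nlinarith [height_sq_add_sq φ (q - z), sq_nonneg (height φ (q - z))]
  have hq0 : height φ (q - z) = k := by
    rw [height_sub, hkdef, height_sub]; rw [height_sub] at hp0; linarith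
  -- With this bound on the angle, `m * sin α ≤ 12 * ρ * α₀ = k / 4`, so `q` stays above the turned
  -- line.
  set α₀ := k / (48 * ρ) with hα₀
  have hα₀ρ : α₀ * ρ = k / 48 := by rw [hα₀]; field_simp
  have hα₀0 : 0 < α₀ := by positivity
  have hα₀1 : α₀ ≤ 1 / 48 := by
    rw [hα₀, div_le_div_iff₀ (by positivity) (by norm_num)]; linarith
  set F : ℝ → ℝ≥0∞ := fun θ ↦ volume (Prod.mk θ ⁻¹' commonTransversals p q z w) with hF
  have key : ∀ α ∈ Set.Icc (α₀ / 4) α₀, k / 1000 ≤ |height (φ + α) (w - z)| →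
      ENNReal.ofReal (k / 1000) ≤ F (φ + α) := by
    rintro α ⟨hα1, hα2⟩ hg
    have hα : 0 < α := by linarith
    have hsin : 2 / 3 * α ≤ Real.sin α := by
      have := Real.sin_gt_sub_cube hα
      nlinarith [mul_pos hα hα]
    have hsin' : Real.sin α ≤ α := Real.sin_le hα.le
    have hcos : 9 / 10 ≤ Real.cos α := by
      have := Real.one_sub_sq_div_two_le_cos (x := α)
      nlinarith
    have e1 : height (φ + α) p - height (φ + α) z = - D * Real.sin α := by
      rw [← height_sub, height_add, hp0, hp1]; ring
    have e2 : height (φ + α) q - height (φ + α) z = k * Real.cos α - m * Real.sin α := by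
      rw [← height_sub, height_add, hq0]
    have b1 : k / 1000 ≤ D * Real.sin α := by
      have : 8 * ρ * (2 / 3 * (α₀ / 4)) ≤ D * Real.sin α := by
        gcongr; linarith
      linarith
    have b2 : k / 1000 ≤ k * Real.cos α - m * Real.sin α := by
      have h1 : m * Real.sin α ≤ 12 * ρ * α₀ := by
        have h0 : 0 ≤ Real.sin α := by linarith
        calc m * Real.sin α ≤ 12 * ρ * Real.sin α := by gcongr
          _ ≤ 12 * ρ * α₀ := by gcongr; linarith
      have h2 : k * (9 / 10) ≤ k * Real.cos α := by gcongr
      linarith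
    rw [height_sub] at hg
    have := ofReal_le_volume_uIcc_inter (a := height (φ + α) z) (b := height (φ + α) p)
      (c := height (φ + α) q) (e := height (φ + α) w) (k := k / 1000) (by linarith) (by linarith)
      (by positivity) rfl hg
    refine this.trans (measure_mono ?_)
    rintro s ⟨hs1, hs2⟩
    have hπ1 := Complex.neg_pi_lt_arg (p - z)
    have hπ2 := Complex.arg_le_pi (p - z)
    have hπ3 := Real.pi_lt_four
    exact ⟨⟨by simp only; linarith, by simp only; linarith⟩, hs1, hs2⟩
  have hmeas : MeasurableSet (commonTransversals p q z w) :=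
    (isClosed_commonTransversals p q z w).measurableSet
  have hFm : Measurable F := measurable_measure_prodMk_left hmeas
  set G : Set ℝ := {θ | ENNReal.ofReal (k / 1000) ≤ F θ} with hG
  -- A direction fails only if it is almost parallel to `w - z`; turning by a further `α₀ / 2 = k /
  -- (96 * ρ)` repairs this. Hence `G` has at least half the measure of the interval.
  have hcover : Set.Icc (φ + α₀ / 4) (φ + α₀ / 2) ⊆ G ∪ (fun θ ↦ θ + α₀ / 2) ⁻¹' G := by
    rintro θ ⟨h1, h2⟩
    by_cases h : k / 1000 ≤ |height θ (w - z)|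
    · left
      have := key (θ - φ) ⟨by linarith, by linarith⟩
      rw [add_sub_cancel] at this
      exact this h
    · right
      have := key (θ + α₀ / 2 - φ) ⟨by linarith, by linarith⟩
      rw [add_sub_cancel] at this
      refine this (le_abs_height_add hw hk hkρ ?_ (not_le.1 h))
      rw [hα₀]; field_simp; norm_num
  have hvolG : ENNReal.ofReal (α₀ / 8) ≤ volume G := by
    have h1 : ENNReal.ofReal (α₀ / 4) ≤ volume G + volume G := by
      have := (measure_mono hcover).trans (measure_union_le (μ := volume) _ _)
      rwa [Real.volume_Icc, measure_preimage_add_right,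
        show φ + α₀ / 2 - (φ + α₀ / 4) = α₀ / 4 by ring] at this
    by_contra! h
    have := ENNReal.add_lt_add h h
    rw [← ENNReal.ofReal_add (by positivity) (by positivity)] at this
    refine absurd (h1.trans_lt this) ?_
    rw [show α₀ / 8 + α₀ / 8 = α₀ / 4 by ring]; exact lt_irrefl _
  calc ENNReal.ofReal (κ ^ 2 / (6e7 * ρ ^ 3))
      ≤ ENNReal.ofReal (k / 1000 * (α₀ / 8)) := by
        apply ENNReal.ofReal_le_ofReal
        rw [hα₀, ← hkκ, div_le_iff₀ (by positivity)]
        have : k / 1000 * (k / (48 * ρ) / 8) * (6e7 * ρ ^ 3) = k ^ 2 * (6e7 / 384000 * ρ ^ 2) := by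
          field_simp; norm_num
        rw [this, mul_pow]
        gcongr
        nlinarith
    _ = ENNReal.ofReal (k / 1000) * ENNReal.ofReal (α₀ / 8) :=
        ENNReal.ofReal_mul (by positivity)
    _ ≤ ENNReal.ofReal (k / 1000) * volume G := by gcongr
    _ ≤ ∫⁻ θ, F θ := mul_meas_ge_le_lintegral hFm _
    _ = volume (commonTransversals p q z w) := by
        rw [Measure.volume_eq_prod, Measure.prod_apply hmeas]

/-- Quantitative lower bound for the measure of the lines that meet two segments. -/
lemma volume_commonTransversals {p q z w : ℂ} {ρ : ℝ} (hρ : 0 < ρ) (hw : ‖w - z‖ = ρ)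
    (hpq : ‖q - p‖ = ρ) (hp : 8 * ρ ≤ ‖p - z‖) (hp' : ‖p - z‖ ≤ 12 * ρ)
    (hq : 8 * ρ ≤ ‖q - z‖) (hq' : ‖q - z‖ ≤ 12 * ρ) :
    ENNReal.ofReal (((q - p) * (starRingEnd ℂ) (p - z)).im ^ 2 / (6e7 * ρ ^ 3)) ≤
      volume (commonTransversals p q z w) := by
  rcases lt_trichotomy ((q - p) * (starRingEnd ℂ) (p - z)).im 0 with h | h | h
  · have hsymm : ((p - q) * (starRingEnd ℂ) (q - z)).im =
        -((q - p) * (starRingEnd ℂ) (p - z)).im := by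
      simp [Complex.mul_im]; ring
    have := volume_commonTransversals_of_pos (p := q) (q := p) hρ hw
      (by rw [norm_sub_rev, hpq]) hq hq' hp' (by rw [hsymm]; linarith)
    rwa [hsymm, neg_sq, commonTransversals_comm] at this
  · rw [h]; simp
  · exact volume_commonTransversals_of_pos hρ hw hpq hp hp' hq' h

/-! ### Arcs of the curve leaving a ball -/

/-- Follow the path from `y` to its first exit at distance `ρ`. This arc stays in the closed ball,
and by the intermediate value theorem every line meeting the chord `[y, y']` meets the arc. -/
lemma Path.exists_dist_eq_of_le_dist_target {a b : ℂ} (γ : Path a b) {y : ℂ}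
    (hy : y ∈ Set.range γ) {ρ : ℝ} (hρ : 0 < ρ) (hb : ρ ≤ dist b y) :
    ∃ y' ∈ Set.range γ, dist y' y = ρ ∧ ∀ f : ℂ → ℝ, Continuous f →
      Set.uIcc (f y) (f y') ⊆ f '' (Set.range γ ∩ Metric.closedBall y ρ) := by
  obtain ⟨t₀, rfl⟩ := hy
  have hd : Continuous fun t ↦ dist (γ t) (γ t₀) := by fun_prop
  have hT : IsCompact {t | t₀ ≤ t ∧ ρ ≤ dist (γ t) (γ t₀)} :=
    (isClosed_Ici.inter (isClosed_le continuous_const hd)).isCompact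
  obtain ⟨t₁, ⟨h01, h1⟩, hleast⟩ :=
    hT.exists_isLeast ⟨1, ⟨unitInterval.le_one t₀, by simpa using hb⟩⟩
  have heq : dist (γ t₁) (γ t₀) = ρ := by
    obtain ⟨t, ⟨ht0, ht1⟩, ht⟩ := intermediate_value_Icc h01 hd.continuousOn
      (show ρ ∈ Set.Icc (dist (γ t₀) (γ t₀)) (dist (γ t₁) (γ t₀)) from
        ⟨by simpa using hρ.le, h1⟩)
    have : t = t₁ := le_antisymm ht1 (hleast ⟨ht0, ht.ge⟩)
    rw [← this]; exact ht
  refine ⟨γ t₁, ⟨t₁, rfl⟩, heq, fun f hf s hs ↦ ?_⟩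
  obtain ⟨t, ht, rfl⟩ := intermediate_value_uIcc (f := fun t ↦ f (γ t))
    (hf.comp γ.continuous).continuousOn hs
  rw [Set.uIcc_of_le h01] at ht
  refine ⟨γ t, ⟨⟨t, rfl⟩, ?_⟩, rfl⟩
  rw [Metric.mem_closedBall]
  by_contra! h
  have : t = t₁ := le_antisymm ht.2 (hleast ⟨ht.1, h.le⟩)
  rw [this, heq] at h
  exact lt_irrefl _ h

/-- A curve from `0` to `1` leaves every ball of radius at most `1 / 2` centred on it. -/
lemma Path.exists_dist_eq (γ : Path (0 : ℂ) 1) {y : ℂ} (hy : y ∈ Set.range γ) {ρ : ℝ}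
    (hρ : 0 < ρ) (hρ' : ρ ≤ 1 / 2) :
    ∃ y' ∈ Set.range γ, dist y' y = ρ ∧ ∀ f : ℂ → ℝ, Continuous f →
      Set.uIcc (f y) (f y') ⊆ f '' (Set.range γ ∩ Metric.closedBall y ρ) := by
  have h : (1 : ℝ) ≤ dist (0 : ℂ) y + dist (1 : ℂ) y := by
    have := dist_triangle_right (0 : ℂ) 1 y
    simpa using this
  by_cases h1 : ρ ≤ dist (1 : ℂ) y
  · exact γ.exists_dist_eq_of_le_dist_target hy hρ h1
  · have := γ.symm.exists_dist_eq_of_le_dist_target (y := y) (by simpa using hy) hρ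
      (by linarith)
    simpa using this

/-! ### Elementary bounds for `β`-numbers -/

lemma infEDist_line_le {p q : ℂ} {ρ : ℝ} (hρ : 0 < ρ) (hpq : ‖q - p‖ = ρ) (z : ℂ) :
    Metric.infEDist z (line[ℝ, p, q] : Set ℂ) ≤
      ENNReal.ofReal (|((q - p) * (starRingEnd ℂ) (p - z)).im| / ρ) := by
  set v := q - p with hv
  -- The parameter of the foot of the perpendicular from `z`.
  set c : ℝ := ((z - p) * (starRingEnd ℂ) v).re / ρ ^ 2 with hc
  have hmem : AffineMap.lineMap p q c ∈ (line[ℝ, p, q] : Set ℂ) :=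
    AffineMap.lineMap_mem_affineSpan_pair c p q
  refine (Metric.infEDist_le_edist_of_mem hmem).trans ?_
  rw [edist_dist]
  apply ENNReal.ofReal_le_ofReal
  have hn : v.re ^ 2 + v.im ^ 2 = ρ ^ 2 := by
    rw [← hpq, ← Complex.normSq_eq_norm_sq, Complex.normSq_apply]; ring
  rw [le_div_iff₀ hρ, dist_eq_norm, ← abs_of_pos hρ, ← abs_of_nonneg (norm_nonneg (z - _)),
    ← abs_mul]
  apply le_of_eq
  rw [← sq_eq_sq_iff_abs_eq_abs, mul_pow, ← Complex.normSq_eq_norm_sq, Complex.normSq_apply]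
  have hcρ : c * ρ ^ 2 = (z.re - p.re) * v.re + (z.im - p.im) * v.im := by
    rw [hc, div_mul_cancel₀ _ (by positivity)]
    simp
  simp only [AffineMap.lineMap_apply, vsub_eq_sub, vadd_eq_add, ← hv, Complex.sub_re,
    Complex.sub_im, Complex.add_re, Complex.add_im, Complex.real_smul, Complex.mul_re,
    Complex.mul_im, Complex.ofReal_re, Complex.ofReal_im, zero_mul, sub_zero, add_zero,
    Complex.conj_re, Complex.conj_im]
  rw [← hn] at hcρ ⊢
  set X := z.re - p.re with hX
  set Y := z.im - p.im with hY
  have e1 : z.re - (c * v.re + p.re) = X - c * v.re := by rw [hX]; ring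
  have e2 : z.im - (c * v.im + p.im) = Y - c * v.im := by rw [hY]; ring
  have e3 : v.re * -(p.im - z.im) + v.im * (p.re - z.re) = v.re * Y - v.im * X := by
    rw [hX, hY]; ring
  rw [e1, e2, e3]
  linear_combination (c * (v.re ^ 2 + v.im ^ 2) - (X * v.re + Y * v.im)) * hcρ

lemma line_mem_planeLines {p q : ℂ} (h : p ≠ q) : line[ℝ, p, q] ∈ planeLines := by
  rw [planeLines, Set.mem_ofPred_eq, direction_affineSpan, vectorSpan_pair_rev]
  exact finrank_span_singleton (by simpa [sub_eq_zero] using h.symm)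

lemma betaNumber_le_of_line {K : Set ℂ} {x p q : ℂ} {r : ℝ} {b : ℝ≥0∞} (h : p ≠ q)
    (hb : ∀ z ∈ K, dist z x < r →
      Metric.infEDist z (line[ℝ, p, q] : Set ℂ) / ENNReal.ofReal r ≤ b) :
    betaNumber K x r ≤ b :=
  (iInf₂_le _ (line_mem_planeLines h)).trans (iSup₂_le fun z hz ↦ hb z hz.1 hz.2)

lemma betaNumber_le_one {K : Set ℂ} {x : ℂ} {r : ℝ} : betaNumber K x r ≤ 1 := by
  refine betaNumber_le_of_line (p := x) (q := x + 1) (by simp) fun z _ hz ↦ ?_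
  apply ENNReal.div_le_of_le_mul
  rw [one_mul]
  refine (Metric.infEDist_le_edist_of_mem (left_mem_affineSpan_pair ℝ x (x + 1))).trans ?_
  rw [edist_dist]
  exact ENNReal.ofReal_le_ofReal hz.le

/-- The same line serves both radii; only the normalisation changes, by the factor `r / t ≤ c`. -/
lemma betaNumber_le_mul {K : Set ℂ} {x : ℂ} {t r : ℝ} {c : ℝ} (ht : 0 < t) (htr : t ≤ r)
    (hc : 0 < c) (hrt : r ≤ c * t) :
    betaNumber K x t ≤ ENNReal.ofReal c * betaNumber K x r := by
  rw [betaNumber, betaNumber, ENNReal.mul_iInf_of_ne (by simpa using hc) (by simp)]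
  gcongr with ℓ
  rw [ENNReal.mul_iInf_of_ne (by simpa using hc) (by simp)]
  gcongr with hℓ
  refine iSup₂_le fun z hz ↦ ?_
  have hz' : z ∈ K ∩ Metric.ball x r := ⟨hz.1, Metric.ball_subset_ball htr hz.2⟩
  refine le_trans ?_ (mul_le_mul_right (le_iSup₂ (f := fun z (_ : z ∈ K ∩ Metric.ball x r) ↦
    Metric.infEDist z (ℓ : Set ℂ) / ENNReal.ofReal r) z hz') _)
  apply ENNReal.div_le_of_le_mul
  rw [mul_assoc, ENNReal.mul_comm_div, ← mul_assoc, mul_comm (ENNReal.ofReal c), mul_assoc,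
    ← mul_div_assoc, ← ENNReal.ofReal_mul hc.le]
  apply le_mul_of_one_le_right (zero_le)
  rw [ENNReal.le_div_iff_mul_le (by simp [ht.trans_le htr]) (by simp), one_mul]
  exact ENNReal.ofReal_le_ofReal hrt

/-! ### Non-flatness produces double hits -/

/-- The set of all `(u, θ, s)` such that the line of direction `θ` and height `s` meets `K` in two
points separated by at least `7 ρ` near some point of `K` with real part `u`. -/
def doubleHits (K : Set ℂ) (ρ : ℝ) : Set (ℝ × ℝ × ℝ) :=
  {a | a.2.1 ∈ Set.Icc (-10) 10 ∧ ∃ z ∈ K, z.re = a.1 ∧ ∃ y ∈ K, ∃ y' ∈ K,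
    dist y z ≤ 11 * ρ ∧ dist y' z ≤ 11 * ρ ∧ 7 * ρ ≤ dist y y' ∧
    height a.2.1 y = a.2.2 ∧ height a.2.1 y' = a.2.2}

/-- A continuous image of a compact set of witnesses. It supplies the measurability needed for
Tonelli. -/
lemma isCompact_doubleHits {K : Set ℂ} (hK : IsCompact K) (ρ : ℝ) :
    IsCompact (doubleHits K ρ) := by
  set T : Set (ℝ × ℂ × ℂ × ℂ) := (Set.Icc (-10) 10 ×ˢ K ×ˢ K ×ˢ K) ∩
    {a | dist a.2.2.1 a.2.1 ≤ 11 * ρ ∧ dist a.2.2.2 a.2.1 ≤ 11 * ρ ∧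
      7 * ρ ≤ dist a.2.2.1 a.2.2.2 ∧ height a.1 a.2.2.1 = height a.1 a.2.2.2} with hT
  have hTc : IsCompact T := by
    refine (isCompact_Icc.prod (hK.prod (hK.prod hK))).inter_right ?_
    have h1 : Continuous fun a : ℝ × ℂ × ℂ × ℂ ↦ dist a.2.2.1 a.2.1 := by fun_prop
    have h2 : Continuous fun a : ℝ × ℂ × ℂ × ℂ ↦ dist a.2.2.2 a.2.1 := by fun_prop
    have h3 : Continuous fun a : ℝ × ℂ × ℂ × ℂ ↦ dist a.2.2.1 a.2.2.2 := by fun_prop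
    have h4 : Continuous fun a : ℝ × ℂ × ℂ × ℂ ↦ height a.1 a.2.2.1 := by
      unfold height; fun_prop
    have h5 : Continuous fun a : ℝ × ℂ × ℂ × ℂ ↦ height a.1 a.2.2.2 := by
      unfold height; fun_prop
    exact (isClosed_le h1 continuous_const).inter ((isClosed_le h2 continuous_const).inter
      ((isClosed_le continuous_const h3).inter (isClosed_eq h4 h5)))
  have himg : doubleHits K ρ = (fun a : ℝ × ℂ × ℂ × ℂ ↦ (a.2.1.re, a.1, height a.1 a.2.2.1)) '' T := by
    ext ⟨u, θ, s⟩
    constructor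
    · rintro ⟨hθ, z, hz, rfl, y, hy, y', hy', h1, h2, h3, h4, h5⟩
      exact ⟨(θ, z, y, y'), ⟨⟨hθ, hz, hy, hy'⟩, h1, h2, h3, h4.trans h5.symm⟩, by
        simp only at h4; simp [h4]⟩
    · rintro ⟨⟨θ', z, y, y'⟩, ⟨⟨hθ, hz, hy, hy'⟩, h1, h2, h3, h4⟩, h⟩
      simp only [Prod.mk.injEq] at h
      obtain ⟨rfl, rfl, rfl⟩ := h
      exact ⟨hθ, z, hz, rfl, y, hy, y', hy', h1, h2, h3, rfl, h4.symm⟩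
  rw [himg]
  refine hTc.image ?_
  unfold height; fun_prop

/-- The square of the `β`-number is controlled by the measure of the lines that meet the curve
twice, at separated points, near `x`. -/
lemma betaNumber_sq_le (γ : Path (0 : ℂ) 1) {x : ℂ} (hx : x ∈ Set.range γ) {ρ : ℝ} (hρ : 0 < ρ)
    (hρ' : ρ ≤ 1 / 20) :
    betaNumber (Set.range γ) x ρ ^ 2 ≤
      ENNReal.ofReal (6e7 / ρ) * volume (Prod.mk x.re ⁻¹' doubleHits (Set.range γ) ρ) := by
  set V := volume (Prod.mk x.re ⁻¹' doubleHits (Set.range γ) ρ) with hV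
  -- The competing line through `p` and `q` is chosen before `z`. At distance `10 * ρ` the arc near
  -- `p` stays clear of the arc near any `z` in the ball; `ρ ≤ 1 / 20` is what lets the curve reach
  -- that far.
  obtain ⟨p, hp, hpx, -⟩ := γ.exists_dist_eq hx (ρ := 10 * ρ) (by positivity) (by linarith)
  obtain ⟨q, hq, hqp, hqf⟩ := γ.exists_dist_eq hp hρ (by linarith)
  have hpq : p ≠ q := by
    rintro rfl; rw [dist_self] at hqp; linarith
  have main : ∀ z ∈ Set.range γ, dist z x < ρ →
      ENNReal.ofReal (((q - p) * (starRingEnd ℂ) (p - z)).im ^ 2 / (6e7 * ρ ^ 3)) ≤ V := by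
    intro z hz hzx
    obtain ⟨w, hw, hwz, hwf⟩ := γ.exists_dist_eq hz hρ (by linarith)
    have h1 : dist p x ≤ dist p z + dist z x := dist_triangle _ _ _
    have h2 : dist p z ≤ dist p x + dist z x := dist_triangle_right _ _ _
    have h3 : dist q z ≤ dist q p + dist p z := dist_triangle _ _ _
    have h4 : dist p z ≤ dist q p + dist q z := dist_triangle_left _ _ _
    refine (volume_commonTransversals hρ (by rw [← dist_eq_norm, hwz])
      (by rw [← dist_eq_norm, hqp]) (by rw [← dist_eq_norm]; linarith)
      (by rw [← dist_eq_norm]; linarith) (by rw [← dist_eq_norm]; linarith)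
      (by rw [← dist_eq_norm]; linarith)).trans (measure_mono ?_)
    rintro ⟨θ, s⟩ ⟨hθ, hs1, hs2⟩
    obtain ⟨y, ⟨hy, hyp⟩, hys⟩ := hqf _ (continuous_height_right θ) hs1
    obtain ⟨y', ⟨hy', hyz⟩, hys'⟩ := hwf _ (continuous_height_right θ) hs2
    rw [Metric.mem_closedBall] at hyp hyz
    have h5 : dist y x ≤ dist y p + dist p x := dist_triangle _ _ _
    have h6 : dist y' x ≤ dist y' z + dist z x := dist_triangle _ _ _
    have h7 : dist p z ≤ dist y p + dist y z := dist_triangle_left _ _ _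
    have h8 : dist y z ≤ dist y y' + dist y' z := dist_triangle _ _ _
    exact ⟨hθ, x, hx, rfl, y, hy, y', hy', by linarith, by linarith, by linarith, hys, hys'⟩
  by_cases hVtop : V = ⊤
  · rw [hVtop, ENNReal.mul_top (ENNReal.ofReal_pos.2 (by positivity)).ne']; exact le_top
  have hβ : betaNumber (Set.range γ) x ρ ≤ ENNReal.ofReal √(6e7 / ρ * V.toReal) := by
    refine betaNumber_le_of_line hpq fun z hz hzx ↦ ?_
    apply ENNReal.div_le_of_le_mul
    refine (infEDist_line_le hρ (by rw [← dist_eq_norm, hqp]) z).trans ?_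
    rw [← ENNReal.ofReal_mul (Real.sqrt_nonneg _)]
    apply ENNReal.ofReal_le_ofReal
    have := main z hz hzx
    rw [ENNReal.ofReal_le_iff_le_toReal hVtop, div_le_iff₀ (by positivity)] at this
    rw [div_le_iff₀ hρ, mul_assoc, ← sq]
    apply abs_le_of_sq_le_sq _ (by positivity)
    rw [mul_pow, Real.sq_sqrt (by positivity)]
    refine this.trans (le_of_eq ?_)
    field_simp
  calc betaNumber (Set.range γ) x ρ ^ 2 ≤ ENNReal.ofReal √(6e7 / ρ * V.toReal) ^ 2 := by gcongr
    _ = ENNReal.ofReal (6e7 / ρ) * V := by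
      rw [← ENNReal.ofReal_pow (Real.sqrt_nonneg _), Real.sq_sqrt (by positivity),
        ENNReal.ofReal_mul (by positivity), ENNReal.ofReal_toReal hVtop]

/-! ### Counting double hits on a single line -/

lemma TotallyBounded.exists_finset_separated {Z : Set ℂ} (hZ : TotallyBounded Z) {R : ℝ}
    (hR : 0 < R) :
    ∃ F : Finset ℂ, ↑F ⊆ Z ∧ (F : Set ℂ).Pairwise (fun a b ↦ R < dist a b) ∧
      ∀ z ∈ Z, ∃ a ∈ F, dist z a ≤ R := by
  have hR2 : (R / 2).toNNReal ≠ 0 := by simpa using hR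
  obtain ⟨T, hT, hTc⟩ := Metric.totallyBounded_iff.1 hZ (R / 2) (by positivity)
  have hcov : Metric.IsCover (R / 2).toNNReal Z T := by
    intro z hz
    obtain ⟨a, ha, haz⟩ := Set.mem_iUnion₂.1 (hTc hz)
    refine ⟨a, ha, ?_⟩
    change edist z a ≤ ENNReal.ofReal (R / 2)
    rw [edist_dist]
    exact ENNReal.ofReal_le_ofReal (Metric.mem_ball.1 haz).le
  have hRR : 2 * (R / 2).toNNReal = R.toNNReal := by
    rw [← Real.toNNReal_ofNat, ← Real.toNNReal_mul (by norm_num)]; congr 1; ring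
  have htop : Metric.packingNumber R.toNNReal Z ≠ ⊤ := by
    rw [← hRR]
    refine ne_top_of_le_ne_top ?_ ((Metric.packingNumber_two_mul_le_externalCoveringNumber _ _).trans
      hcov.externalCoveringNumber_le_encard)
    simpa using hT
  have hfin : (Metric.maximalSeparatedSet R.toNNReal Z).Finite := by
    rw [← Set.encard_ne_top_iff, Metric.encard_maximalSeparatedSet htop]; exact htop
  refine ⟨hfin.toFinset, by simpa using Metric.maximalSeparatedSet_subset, ?_, ?_⟩
  · rw [Set.Finite.coe_toFinset]
    intro a ha b hb hab
    have := Metric.isSeparated_maximalSeparatedSet ha hb hab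
    change ENNReal.ofReal R < edist a b at this
    rw [edist_dist] at this
    exact (ENNReal.ofReal_lt_ofReal_iff_of_nonneg hR.le).1 this
  · intro z hz
    obtain ⟨a, ha, haz⟩ := Metric.isCover_maximalSeparatedSet htop hz
    refine ⟨a, by simpa using ha, ?_⟩
    change edist z a ≤ ENNReal.ofReal R at haz
    rw [edist_dist] at haz
    exact (ENNReal.ofReal_le_ofReal_iff hR.le).1 haz

/-- Passing to a finer scale, a separated subset of a level line can be enlarged by one point for
each separated ball in which the line meets `K` twice. -/
lemma exists_finset_separated_extension {K : Set ℂ} (hK : TotallyBounded K) {θ s ρ : ℝ}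
    (hρ : 0 < ρ) (X : Finset ℂ) (hX : ∀ y ∈ X, y ∈ K ∧ height θ y = s)
    (hsep : (X : Set ℂ).Pairwise (fun a b ↦ 40 * ρ < dist a b)) :
    ∃ Y : Finset ℂ, (∀ y ∈ Y, y ∈ K ∧ height θ y = s) ∧
      (Y : Set ℂ).Pairwise (fun a b ↦ 5 / 2 * ρ < dist a b) ∧
      volume ((fun u ↦ (u, θ, s)) ⁻¹' doubleHits K ρ) / ENNReal.ofReal (100 * ρ) + X.card ≤
        Y.card := by
  classical
  set Z : Set ℂ := {z ∈ K | ∃ y ∈ K, ∃ y' ∈ K, dist y z ≤ 11 * ρ ∧ dist y' z ≤ 11 * ρ ∧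
    7 * ρ ≤ dist y y' ∧ height θ y = s ∧ height θ y' = s} with hZ
  obtain ⟨F, hFZ, hFsep, hFcov⟩ := (hK.subset (Set.sep_subset _ _ : Z ⊆ K)).exists_finset_separated
    (R := 50 * ρ) (by positivity)
  have hex : ∀ z ∈ F, ∃ y ∈ K, height θ y = s ∧ dist y z ≤ 11 * ρ ∧
      ∀ a ∈ X, 7 / 2 * ρ ≤ dist y a := by
    intro z hz
    obtain ⟨-, y, hy, y', hy', h1, h2, h3, h4, h5⟩ := hFZ hz
    -- If both hits were within `7 / 2 * ρ` of `X`, a common nearby point would contradict their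
    -- separation `7 * ρ`, and two distinct ones would be less than `29 * ρ` apart.
    by_contra! h
    obtain ⟨a, ha, hya⟩ := h y hy h4 h1
    obtain ⟨b, hb, hyb⟩ := h y' hy' h5 h2
    by_cases hab : a = b
    · subst hab
      have := dist_triangle_right y y' a
      linarith
    · have := hsep ha hb hab
      have h6 : dist a b ≤ dist y a + dist y b := dist_triangle_left _ _ _
      have h7 : dist y b ≤ dist y z + dist z b := dist_triangle _ _ _
      have h8 : dist z b ≤ dist y' z + dist y' b := dist_triangle_left _ _ _
      linarith
  choose! g hgK hgs hgz hgX using hex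
  have hgsep : ∀ a ∈ F, ∀ b ∈ F, a ≠ b → 28 * ρ < dist (g a) (g b) := by
    intro a ha b hb hab
    have h1 := hFsep ha hb hab
    have h2 : dist a b ≤ dist (g a) a + dist (g a) b := dist_triangle_left _ _ _
    have h3 : dist (g a) b ≤ dist (g a) (g b) + dist (g b) b := dist_triangle _ _ _
    have := hgz a ha
    have := hgz b hb
    linarith
  have hinj : Set.InjOn g F := by
    intro a ha b hb hab
    by_contra hne
    have := hgsep a ha b hb hne
    rw [hab, dist_self] at this
    linarith
  have hdisj : Disjoint (F.image g) X := by
    rw [Finset.disjoint_left]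
    intro y hy hyX
    obtain ⟨a, ha, rfl⟩ := Finset.mem_image.1 hy
    have := hgX a ha _ hyX
    rw [dist_self] at this
    linarith
  refine ⟨F.image g ∪ X, ?_, ?_, ?_⟩
  · intro y hy
    rcases Finset.mem_union.1 hy with hy | hy
    · obtain ⟨a, ha, rfl⟩ := Finset.mem_image.1 hy
      exact ⟨hgK a ha, hgs a ha⟩
    · exact hX y hy
  · intro y hy y' hy' hne
    rcases Finset.mem_union.1 hy with hy | hy <;> rcases Finset.mem_union.1 hy' with hy' | hy'
    · obtain ⟨a, ha, rfl⟩ := Finset.mem_image.1 hy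
      obtain ⟨b, hb, rfl⟩ := Finset.mem_image.1 hy'
      have := hgsep a ha b hb (fun h ↦ hne (h ▸ rfl))
      linarith
    · obtain ⟨a, ha, rfl⟩ := Finset.mem_image.1 hy
      have := hgX a ha y' hy'
      linarith
    · obtain ⟨a, ha, rfl⟩ := Finset.mem_image.1 hy'
      have := hgX a ha y hy
      rw [dist_comm] at this
      linarith
    · have := hsep hy hy' hne
      linarith
  · rw [Finset.card_union_of_disjoint hdisj, Finset.card_image_of_injOn hinj, Nat.cast_add]
    gcongr
    apply ENNReal.div_le_of_le_mul
    -- The real parts of the `50 * ρ`-balls around `F` cover the slice, so `F` has at least its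
    -- length divided by `100 * ρ` elements.
    have hsub : (fun u ↦ (u, θ, s)) ⁻¹' doubleHits K ρ ⊆
        ⋃ a ∈ F, Set.Icc (a.re - 50 * ρ) (a.re + 50 * ρ) := by
      rintro u ⟨-, z, hz, rfl, h⟩
      obtain ⟨a, ha, hza⟩ := hFcov z ⟨hz, h⟩
      refine Set.mem_biUnion ha ?_
      have := Complex.abs_re_le_norm (z - a)
      rw [← dist_eq_norm] at this
      replace this := this.trans hza
      rw [Complex.sub_re, abs_le] at this
      exact ⟨by linarith, by linarith⟩
    refine (measure_mono hsub).trans ((measure_biUnion_finset_le _ _).trans (le_of_eq ?_))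
    simp_rw [Real.volume_Icc]
    rw [Finset.sum_congr rfl fun a _ ↦ by
      rw [show a.re + 50 * ρ - (a.re - 50 * ρ) = 100 * ρ by ring], Finset.sum_const, nsmul_eq_mul]

/-- The dyadic-type scales `16 ^ (-(k + 2))`. -/
noncomputable def scale (k : ℕ) : ℝ := (1 / 16) ^ (k + 2)

lemma scale_pos (k : ℕ) : 0 < scale k := by unfold scale; positivity

lemma scale_succ (k : ℕ) : scale (k + 1) = scale k / 16 := by
  unfold scale; ring

lemma scale_le (k : ℕ) : scale k ≤ 1 / 20 := by
  have : scale k ≤ (1 / 16) ^ 2 := pow_le_pow_of_le_one (by norm_num) (by norm_num) (by omega)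
  linarith

/-- The ratio 16 of the scales makes the induction close: the extension is separated by `5 / 2 *
scale n = 40 * scale (n + 1)`. -/
lemma exists_finset_sum_doubleHits_le {K : Set ℂ} (hK : TotallyBounded K) (θ s : ℝ) (n : ℕ) :
    ∃ X : Finset ℂ, (∀ y ∈ X, y ∈ K ∧ height θ y = s) ∧
      (X : Set ℂ).Pairwise (fun a b ↦ 40 * scale n < dist a b) ∧
      ∑ k ∈ Finset.range n, volume ((fun u ↦ (u, θ, s)) ⁻¹' doubleHits K (scale k)) /
        ENNReal.ofReal (100 * scale k) ≤ X.card := by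
  induction n with
  | zero => exact ⟨∅, by simp, by simp, by simp⟩
  | succ n ih =>
    obtain ⟨X, hX, hsep, hsum⟩ := ih
    obtain ⟨Y, hY, hYsep, hYsum⟩ := exists_finset_separated_extension hK (scale_pos n) X hX hsep
    refine ⟨Y, hY, hYsep.mono' fun a b h ↦ ?_, ?_⟩
    · rw [scale_succ]
      linarith
    · rw [Finset.sum_range_succ, add_comm]
      exact (by gcongr : _ ≤ _).trans hYsum

/-! ### Integration over all lines -/

/-- A set separated at the scale of a cover has at most as many points as the cover has members
meeting it. -/
lemma card_le_tsum_indicator {U : ℕ → Set ℂ} {X : Finset ℂ} {δ θ s : ℝ}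
    (hU : ∀ i, Metric.ediam (U i) ≤ ENNReal.ofReal δ) (hδ : 0 ≤ δ)
    (hX : (X : Set ℂ) ⊆ ⋃ i, U i) (hs : ∀ y ∈ X, height θ y = s)
    (hsep : (X : Set ℂ).Pairwise (fun a b ↦ δ < dist a b)) :
    (X.card : ℝ≥0∞) ≤ ∑' i, (closure (height θ '' U i)).indicator 1 s := by
  classical
  have hex : ∀ y ∈ X, ∃ i, y ∈ U i := fun y hy ↦ Set.mem_iUnion.1 (hX hy)
  choose! f hf using hex
  have hinj : Set.InjOn f X := by
    intro a ha b hb hab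
    by_contra hne
    have h1 := (Metric.edist_le_ediam_of_mem (hf a ha) (hab ▸ hf b hb)).trans (hU _)
    rw [edist_dist, ENNReal.ofReal_le_ofReal_iff hδ] at h1
    exact absurd (hsep ha hb hne) (not_lt.2 h1)
  calc (X.card : ℝ≥0∞) = ∑ i ∈ X.image f, 1 := by
        rw [Finset.sum_const, Finset.card_image_of_injOn hinj, nsmul_eq_mul, mul_one]
    _ ≤ ∑ i ∈ X.image f, (closure (height θ '' U i)).indicator 1 s := by
        refine Finset.sum_le_sum fun i hi ↦ ?_
        obtain ⟨a, ha, rfl⟩ := Finset.mem_image.1 hi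
        have hmem : s ∈ closure (height θ '' U (f a)) :=
          subset_closure ⟨a, hf a ha, hs a ha⟩
        rw [Set.indicator_of_mem hmem, Pi.one_apply]
    _ ≤ _ := ENNReal.sum_le_tsum _

/-- Integral-geometric bound, for a fixed direction: the number of scales at which lines of that
direction meet `K` twice is controlled by the length of `K`. -/
lemma lintegral_sum_doubleHits_le {K : Set ℂ} (hK : TotallyBounded K) {L : ℝ≥0∞}
    (hL : μH[1] K < L) (θ : ℝ) (n : ℕ) :
    ∫⁻ s, ∑ k ∈ Finset.range n, volume ((fun u ↦ (u, θ, s)) ⁻¹' doubleHits K (scale k)) /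
      ENNReal.ofReal (100 * scale k) ≤ L := by
  have hδ : 0 < 40 * scale n := by have := scale_pos n; positivity
  rw [Measure.hausdorffMeasure_apply] at hL
  have h1 := (le_iSup₂ (f := fun (r : ℝ≥0∞) (_ : 0 < r) ↦
    ⨅ (t : ℕ → Set ℂ) (_ : K ⊆ ⋃ n, t n) (_ : ∀ n, Metric.ediam (t n) ≤ r),
      ∑' n, ⨆ _ : (t n).Nonempty, Metric.ediam (t n) ^ (1 : ℝ))
    (ENNReal.ofReal (40 * scale n)) (ENNReal.ofReal_pos.2 hδ)).trans_lt hL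
  simp only [iInf_lt_iff] at h1
  obtain ⟨U, hKU, hU, hsum⟩ := h1
  -- Closures make the images measurable without increasing their diameters.
  calc _ ≤ ∫⁻ s, ∑' i, (closure (height θ '' U i)).indicator 1 s := by
        refine lintegral_mono fun s ↦ ?_
        obtain ⟨X, hX, hsep, hle⟩ := exists_finset_sum_doubleHits_le hK θ s n
        exact hle.trans (card_le_tsum_indicator hU hδ.le (fun y hy ↦ hKU (hX y hy).1)
          (fun y hy ↦ (hX y hy).2) hsep)
    _ = ∑' i, volume (closure (height θ '' U i)) := by
        rw [lintegral_tsum fun i ↦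
          (measurable_one.indicator isClosed_closure.measurableSet).aemeasurable]
        simp_rw [lintegral_indicator_one isClosed_closure.measurableSet]
    _ ≤ ∑' i, ⨆ _ : (U i).Nonempty, Metric.ediam (U i) ^ (1 : ℝ) := by
        refine ENNReal.tsum_le_tsum fun i ↦ ?_
        rcases (U i).eq_empty_or_nonempty with h | h
        · simp [h]
        · simp only [h, iSup_pos, ENNReal.rpow_one]
          refine (Real.volume_le_diam _).trans ?_
          rw [Metric.ediam_closure]
          simpa using (lipschitzWith_height θ).ediam_image_le (U i)
    _ ≤ L := hsum.le

/-- Summing over all directions and exchanging the integrals. -/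
lemma sum_volume_doubleHits_le {K : Set ℂ} (hK : IsCompact K) {L : ℝ≥0∞}
    (hL : μH[1] K < L) (n : ℕ) :
    ∑ k ∈ Finset.range n, volume (doubleHits K (scale k)) / ENNReal.ofReal (100 * scale k) ≤
      20 * L := by
  have hm : ∀ k, MeasurableSet (doubleHits K (scale k)) := fun k ↦
    (isCompact_doubleHits hK _).isClosed.measurableSet
  have hmeas : ∀ k, Measurable fun a : ℝ × ℝ ↦
      volume ((fun u ↦ (u, a)) ⁻¹' doubleHits K (scale k)) / ENNReal.ofReal (100 * scale k) :=
    fun k ↦ (measurable_measure_prodMk_right (hm k)).div_const _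
  have hv : ∀ k, volume (doubleHits K (scale k)) / ENNReal.ofReal (100 * scale k) =
      ∫⁻ a : ℝ × ℝ, volume ((fun u ↦ (u, a)) ⁻¹' doubleHits K (scale k)) /
        ENNReal.ofReal (100 * scale k) := by
    intro k
    simp_rw [div_eq_mul_inv]
    rw [lintegral_mul_const _ (measurable_measure_prodMk_right (hm k)),
      ← Measure.prod_apply_symm (hm k)]
    rfl
  simp_rw [hv]
  rw [← lintegral_finsetSum _ fun k _ ↦ hmeas k, Measure.volume_eq_prod,
    lintegral_prod _ (Finset.measurable_sum _ fun k _ ↦ hmeas k).aemeasurable]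
  calc _ ≤ ∫⁻ θ : ℝ, (Set.Icc (-10 : ℝ) 10).indicator (fun _ ↦ L) θ := by
        refine lintegral_mono fun θ ↦ ?_
        by_cases hθ : θ ∈ Set.Icc (-10 : ℝ) 10
        · rw [Set.indicator_of_mem hθ]
          exact lintegral_sum_doubleHits_le hK.totallyBounded hL θ n
        · rw [Set.indicator_of_notMem hθ]
          have hempty : ∀ s k, (fun u ↦ (u, θ, s)) ⁻¹' doubleHits K (scale k) = ∅ := fun s k ↦
            Set.eq_empty_of_forall_notMem fun u hu ↦ hθ hu.1
          simp [hempty]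
    _ = 20 * L := by
        rw [lintegral_indicator_const measurableSet_Icc, Real.volume_Icc, mul_comm]
        norm_num

/-! ### From scales to the integral, and conclusion -/

lemma Ioc_zero_one_subset_scales :
    Set.Ioc (0 : ℝ) 1 ⊆
      Set.Ioc (scale 0) 1 ∪ ⋃ k, Set.Ioc (scale (k + 1)) (scale k) := by
  rintro t ⟨ht0, ht1⟩
  by_cases h : scale 0 < t
  · exact Or.inl ⟨h, ht1⟩
  · have h0 : scale 0 = 1 / 256 := by norm_num [scale]
    obtain ⟨n, hn1, hn2⟩ := exists_nat_pow_near_of_lt_one (x := 256 * t) (y := 1 / 16)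
      (by positivity) (by linarith) (by norm_num) (by norm_num)
    refine Or.inr (Set.mem_iUnion.2 ⟨n, ?_, ?_⟩)
    · rw [scale, pow_add]; linarith
    · rw [scale, pow_add]; linarith

/-- Discretization of the integral defining `betaInfinity`. -/
lemma betaInfinity_le_tsum (K : Set ℂ) (x : ℂ) :
    betaInfinity K x ≤ 256 + 4096 * ∑' k, betaNumber K x (scale k) ^ 2 := by
  rw [betaInfinity]
  refine (lintegral_mono_set Ioc_zero_one_subset_scales).trans ((lintegral_union_le _ _ _).trans ?_)
  have h0 : scale 0 = 1 / 256 := by norm_num [scale]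
  refine add_le_add ?_ ?_
  · calc _ ≤ ∫⁻ _ in Set.Ioc (scale 0) 1, 256 := by
          refine setLIntegral_mono measurable_const fun t ht ↦ ?_
          apply ENNReal.div_le_of_le_mul
          refine (pow_le_one₀ zero_le betaNumber_le_one).trans ?_
          rw [show (256 : ℝ≥0∞) = ENNReal.ofReal 256 by norm_num,
            ← ENNReal.ofReal_mul (by norm_num), ENNReal.one_le_ofReal]
          linarith [ht.1]
      _ ≤ 256 := by
          rw [setLIntegral_const, Real.volume_Ioc]
          apply mul_le_of_le_one_right zero_le
          rw [ENNReal.ofReal_le_one]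
          linarith
  · refine (lintegral_iUnion_le _ _).trans ?_
    rw [← ENNReal.tsum_mul_left]
    refine ENNReal.tsum_le_tsum fun k ↦ ?_
    have hk := scale_pos k
    calc _ ≤ ∫⁻ _ in Set.Ioc (scale (k + 1)) (scale k),
            (ENNReal.ofReal 16 * betaNumber K x (scale k)) ^ 2 /
              ENNReal.ofReal (scale k / 16) := by
          refine setLIntegral_mono measurable_const fun t ht ↦ ?_
          rw [scale_succ] at ht
          have ht1 := ht.1
          gcongr
          exact betaNumber_le_mul (by linarith) ht.2 (by norm_num) (by linarith)
      -- Here `16 ^ 2` comes from changing the radius and the other factor 16 from `1 / t`; the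
      -- interval is no longer than `scale k`.
      _ ≤ 4096 * betaNumber K x (scale k) ^ 2 := by
          rw [setLIntegral_const, Real.volume_Ioc, mul_pow, ENNReal.mul_div_right_comm, mul_assoc,
            mul_comm (_ ^ 2 : ℝ≥0∞) (ENNReal.ofReal (_ - _)), ← mul_assoc]
          gcongr
          rw [← ENNReal.ofReal_pow (by norm_num), ← ENNReal.ofReal_div_of_pos (by positivity),
            ← ENNReal.ofReal_mul (by positivity),
            show (4096 : ℝ≥0∞) = ENNReal.ofReal 4096 by norm_num]
          apply ENNReal.ofReal_le_ofReal
          rw [scale_succ, div_mul_eq_mul_div, div_le_iff₀ (by positivity)]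
          linarith

/-- Along the real projection of a curve of finite length, `betaInfinity` is integrable in a
quantitative way: any lower bound for it over a measurable set of abscissas is bounded by the
length. -/
lemma ofReal_mul_volume_le (γ : Path (0 : ℂ) 1) {L : ℝ≥0∞} (hL : μH[1] (Set.range γ) < L) {M : ℝ}
    {U : Set ℝ} (hU : U ⊆ Set.Icc 0 1)
    (hM : ∀ z ∈ Set.range γ, z.re ∈ U → ENNReal.ofReal M ≤ betaInfinity (Set.range γ) z) :
    ENNReal.ofReal M * volume U ≤ 256 + 4096 * (6000000000 * (20 * L)) := by
  set K := Set.range γ with hKdef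
  have hK : IsCompact K := isCompact_range γ.continuous
  have hm : ∀ k, MeasurableSet (doubleHits K (scale k)) := fun k ↦
    (isCompact_doubleHits hK _).isClosed.measurableSet
  set f : ℕ → ℝ → ℝ≥0∞ := fun k u ↦
    ENNReal.ofReal (6e7 / scale k) * volume (Prod.mk u ⁻¹' doubleHits K (scale k)) with hf
  have hfm : ∀ k, Measurable (f k) := fun k ↦
    (measurable_measure_prodMk_left (hm k)).const_mul _
  have hlow : ∀ u ∈ U, ENNReal.ofReal M ≤ 256 + 4096 * ∑' k, f k u := by
    -- The curve joins `0` to `1`, so it has a point over every abscissa in `[0, 1]`.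
    intro u hu
    obtain ⟨t, -, rfl⟩ := intermediate_value_Icc (f := fun t ↦ (γ t).re)
      (unitInterval.nonneg' : (0 : unitInterval) ≤ 1)
      (Complex.continuous_re.comp γ.continuous).continuousOn
      (show u ∈ Set.Icc (γ 0).re (γ 1).re by simpa using hU hu)
    refine (hM (γ t) ⟨t, rfl⟩ hu).trans ((betaInfinity_le_tsum K (γ t)).trans ?_)
    gcongr with k
    exact betaNumber_sq_le γ ⟨t, rfl⟩ (scale_pos k) (scale_le k)
  have hint : ∀ k, ∫⁻ u, f k u =
      6000000000 * (volume (doubleHits K (scale k)) / ENNReal.ofReal (100 * scale k)) := by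
    intro k
    have hk := scale_pos k
    rw [lintegral_const_mul _ (measurable_measure_prodMk_left (hm k)),
      ← Measure.prod_apply (hm k), ← Measure.volume_eq_prod,
      ENNReal.div_eq_inv_mul, ← mul_assoc,
      ← ENNReal.ofReal_inv_of_pos (by positivity),
      show (6000000000 : ℝ≥0∞) = ENNReal.ofReal 6000000000 by norm_num, ← ENNReal.ofReal_mul (by norm_num)]
    congr 2
    field_simp
    norm_num
  calc ENNReal.ofReal M * volume U = ∫⁻ _ in U, ENNReal.ofReal M := by rw [setLIntegral_const]
    _ ≤ ∫⁻ u in U, 256 + 4096 * ∑' k, f k u :=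
        setLIntegral_mono (by fun_prop) hlow
    _ = 256 * volume U + 4096 * ∫⁻ u in U, ∑' k, f k u := by
        rw [lintegral_add_left measurable_const, setLIntegral_const,
          lintegral_const_mul _ (Measurable.tsum hfm)]
    _ ≤ 256 * 1 + 4096 * ∫⁻ u, ∑' k, f k u := by
        gcongr
        · exact (measure_mono hU).trans (by simp)
        · exact Measure.restrict_le_self
    _ ≤ 256 + 4096 * (6000000000 * (20 * L)) := by
        rw [mul_one, lintegral_tsum fun k ↦ (hfm k).aemeasurable]
        simp_rw [hint]
        rw [ENNReal.tsum_mul_left]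
        gcongr
        exact ENNReal.tsum_le_of_sum_range_le fun n ↦ sum_volume_doubleHits_le hK hL n

theorem proposition1 (ε L : ℝ) (hε0 : 0 ≤ ε) (hε1 : ε < 1) (hL : 1 < L) :
    ∃ M : ℝ, 0 < M ∧
      ∀ (γ : Path (0 : ℂ) 1) (E : Set ℂ),
        μH[1] E ≤ ENNReal.ofReal ε →
        (∀ x ∈ Set.range γ \ E, ENNReal.ofReal M ≤ betaInfinity (Set.range γ) x) →
        ENNReal.ofReal L < μH[1] (Set.range γ) := by
  have hε : 0 < 1 - ε := by linarith
  set C : ℝ := 256 + 4096 * (6000000000 * (20 * (L + 1))) with hC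
  have hC0 : 0 < C := by positivity
  refine ⟨(C + 1) / (1 - ε), by positivity, fun γ E hE hβ ↦ ?_⟩
  by_contra! hlen
  -- The real part is 1-Lipschitz, so the shadow of `E` has measure at most `ε`; every point of the
  -- curve over an abscissa outside `N` lies outside `E`.
  set N := toMeasurable volume (Complex.re '' E) with hN
  have hre : LipschitzWith 1 Complex.re := by
    refine LipschitzWith.of_dist_le_mul fun y z ↦ ?_
    rw [Real.dist_eq, ← Complex.sub_re, dist_eq_norm, NNReal.coe_one, one_mul]
    exact Complex.abs_re_le_norm _
  have hNε : volume N ≤ ENNReal.ofReal ε := by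
    rw [hN, measure_toMeasurable, ← hausdorffMeasure_real]
    refine (hre.hausdorffMeasure_image_le zero_le_one E).trans ?_
    simpa using hE
  have hUvol : ENNReal.ofReal (1 - ε) ≤ volume (Set.Icc (0 : ℝ) 1 \ N) := by
    rw [ENNReal.ofReal_sub _ hε0, tsub_le_iff_right]
    calc ENNReal.ofReal 1 = volume (Set.Icc (0 : ℝ) 1) := by simp
      _ ≤ volume (Set.Icc (0 : ℝ) 1 \ N) + volume N := by
          refine (measure_mono ?_).trans (measure_union_le _ _)
          rw [Set.sdiff_union_self]; exact Set.subset_union_left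
      _ ≤ _ := by gcongr
  -- Passing to `L + 1` gives the strict inequality used to extract a cover from the Hausdorff
  -- measure.
  have hlt : μH[1] (Set.range γ) < ENNReal.ofReal (L + 1) :=
    hlen.trans_lt ((ENNReal.ofReal_lt_ofReal_iff (by linarith)).2 (by linarith))
  have hmain := ofReal_mul_volume_le γ hlt (M := (C + 1) / (1 - ε)) 
    (U := Set.Icc 0 1 \ N) Set.sdiff_subset fun z hz hzU ↦ hβ z ⟨hz, fun hzE ↦ hzU.2
      (subset_toMeasurable _ _ (Set.mem_image_of_mem Complex.re hzE))⟩
  have hle : ENNReal.ofReal (C + 1) ≤ ENNReal.ofReal C :=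
    calc ENNReal.ofReal (C + 1)
        = ENNReal.ofReal ((C + 1) / (1 - ε)) * ENNReal.ofReal (1 - ε) := by
          rw [← ENNReal.ofReal_mul (by positivity), div_mul_cancel₀ _ hε.ne']
      _ ≤ ENNReal.ofReal ((C + 1) / (1 - ε)) * volume (Set.Icc (0 : ℝ) 1 \ N) := by gcongr
      _ ≤ 256 + 4096 * (6000000000 * (20 * ENNReal.ofReal (L + 1))) := hmain
      _ = ENNReal.ofReal C := by
          rw [hC, ENNReal.ofReal_add (p := 256) (by norm_num) (by positivity),
            ENNReal.ofReal_mul (by norm_num), ENNReal.ofReal_mul (by norm_num),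
            ENNReal.ofReal_mul (by norm_num)]
          norm_num
  rw [ENNReal.ofReal_le_ofReal_iff hC0.le] at hle
  linarith
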